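/- Let $\mathbb{F}\in\{\mathbb{R},\mathbb{C}\}$, $p\in\{1,\infty\}$ and let $m,n\ge 2$ be integers. Let $\mathcal{X}=\mathcal{L}(\ell_p^n,\ell_p^m)$ be the space of $\mathbb{F}$-linear operators from $\ell_p^n=(\mathbb{F}^n,\|\cdot\|_p)$ to $\ell_p^m=(\mathbb{F}^m,\|\cdot\|_p)$ with the operator norm. Call $x,y\in\mathcal{X}$ a triangle-equality-attaining (TEA) pair if $\|x+y\|=\|x\|+\|y\|$, and a parallel pair if $\|x+\lambda y\|=\|x\|+\|y\|$ for some $\lambda\in\mathbb{F}$ with $|\lambda|=1$. A linear map $T:\mathcal{X}\to\mathcal{X}$ preserves TEA (resp. parallel) pairs if $T(x),T(y)$ is a TEA (resp. parallel) pair whenever $x,y$ is one. Let $T:\mathcal{X}\to\mathcal{X}$ be a non-zero linear map. Then the following are equivalent: 1. $T$ preserves TEA pairs; 2. $T$ preserves parallel pairs and $\operatorname{rank}(T)>1$; 3. $T$ preserves parallel pairs and $T$ is invertible; 4. $T$ is a scalar multiple of an isometry, i.e. $T=cU$ with $c\in\mathbb{F}$ and $U:\mathcal{X}\to\mathcal{X}$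 linear with $\|U(x)\|=\|x\|$ for all $x\in\mathcal{X}$. -/

import Mathlib

open scoped ENNReal

/-- `x` and `y` form a triangle equality attaining (TEA) pair: `‖x + y‖ = ‖x‖ + ‖y‖`. -/
def IsTEAPair {X : Type*} [NormedAddCommGroup X] (x y : X) : Prop :=
  ‖x + y‖ = ‖x‖ + ‖y‖

/-- `x` and `y` are parallel over `𝕜`: `‖x + c • y‖ = ‖x‖ + ‖y‖` for some scalar `c` of
modulus one. -/
def IsParallelPair (𝕜 : Type*) {X : Type*} [RCLike 𝕜] [NormedAddCommGroup X]
    [NormedSpace 𝕜 X] (x y : X) : Prop :=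
  ∃ c : 𝕜, ‖c‖ = 1 ∧ ‖x + c • y‖ = ‖x‖ + ‖y‖

/-- A linear map preserves TEA pairs. -/
def PreservesTEAPairs {𝕜 X : Type*} [RCLike 𝕜] [NormedAddCommGroup X]
    [NormedSpace 𝕜 X] (T : X →ₗ[𝕜] X) : Prop :=
  ∀ x y : X, IsTEAPair x y → IsTEAPair (T x) (T y)

/-- A linear map preserves parallel pairs. -/
def PreservesParallelPairs {𝕜 X : Type*} [RCLike 𝕜] [NormedAddCommGroup X]
    [NormedSpace 𝕜 X] (T : X →ₗ[𝕜] X) : Prop :=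
  ∀ x y : X, IsParallelPair 𝕜 x y → IsParallelPair 𝕜 (T x) (T y)

/-- A linear map is a scalar multiple of an isometry. -/
def IsScalarMultipleOfIsometry {𝕜 X : Type*} [RCLike 𝕜] [NormedAddCommGroup X]
    [NormedSpace 𝕜 X] (T : X →ₗ[𝕜] X) : Prop :=
  ∃ (c : 𝕜) (U : X →ₗᵢ[𝕜] X), T = c • U.toLinearMap

/-- The space `L(ℓ_p^n, ℓ_p^m)` of linear operators, with the operator norm (every linear
operator between these finite-dimensional spaces is continuous). -/
abbrev OpSpace (𝕜 : Type*) [RCLike 𝕜] (p : ℝ≥0∞) [Fact (1 ≤ p)] (n m : ℕ) : Type _ :=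
  PiLp p (fun _ : Fin n => 𝕜) →L[𝕜] PiLp p (fun _ : Fin m => 𝕜)

/-! Listing an operator by its columns (`p = 1`) or its rows (`p = ∞`) identifies the operator space
isometrically with an `ℓ∞`-sum of `ℓ₁` spaces, `RowSpace`. There a `vertex` is parallel to every
array, so if `T` preserves parallel pairs its image is parallel to the whole range of `T`. The
derivative of the norm at a smooth point of the range has modulus `‖z‖` at every `z` parallel to
that point. Composed with `T`, these derivatives give functionals that share the modulus `‖T y‖` at
each vertex `y`; they separate points of the range because smooth points are dense.

Polarization turns equal moduli into equal products of values. If `T` kills a nonzero array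
supported in one row, so many vectors become universal that all test functionals are proportional
and `T` has rank at most one. Otherwise each test functional lives on a single row, which forces `T`
to be injective, hence bijective. The extreme points of the dual ball, composed with `T`, are then
also test functionals, and each turns out to be one fixed constant `c > 0` times an extreme point.
Hence `‖T x‖ ≤ c‖x‖`. The reverse inequality follows over the reals by finiteness of the set of
extreme points, and over the complex numbers because `T` must be monomial up to scalars.

A nonzero map preserving TEA pairs cannot have rank one, by testing on matrix units; this also shows
that the space has dimension above one, so invertible maps qualify. -/

open scoped ComplexConjugate

/-! ### Norm derivatives, test functionals and polarization -/

section General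

variable {𝕜 : Type*} [RCLike 𝕜] {X : Type*} [NormedAddCommGroup X] [NormedSpace 𝕜 X]

/-- In a finite-dimensional normed space, the functionals that attain the norm on everything
parallel to some fixed vector separate points. -/
theorem exists_functional_norm_eq_of_parallel [FiniteDimensional 𝕜 X] (v : X) (hv : v ≠ 0) :
    ∃ F : X →ₗ[𝕜] 𝕜, F v ≠ 0 ∧ ∃ x, ∀ y, IsParallelPair 𝕜 x y → ‖F y‖ = ‖y‖ := by
  let _ : NormedSpace ℝ X := NormedSpace.restrictScalars ℝ 𝕜 X
  have _ : IsScalarTower ℝ 𝕜 X := ⟨fun a b x => by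
    rw [RCLike.real_smul_eq_coe_smul (K := 𝕜) a b, smul_assoc]; rfl⟩
  have _ : FiniteDimensional ℝ X := FiniteDimensional.trans ℝ 𝕜 X
  have hv' : 0 < ‖v‖ := norm_pos_iff.mpr hv
  -- Within `‖v‖ / 2` of `v`, the bound `‖F v‖ ≥ ‖x‖ - ‖v - x‖ ≥ ‖v‖ - 2‖v - x‖` stays positive.
  obtain ⟨x, hx, hxv⟩ := (dense_differentiableAt_norm (E := X)).exists_dist_lt v
    (half_pos hv')
  rw [dist_eq_norm] at hxv
  set D := fderiv ℝ (fun y : X => ‖y‖) x with hD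
  have hDle : ‖D‖ ≤ 1 := by
    simpa using norm_fderiv_le_of_lipschitz ℝ (lipschitzWith_one_norm (E := X)) (x₀ := x)
  let F : StrongDual 𝕜 X := StrongDual.extendRCLike D
  have hF : ∀ y, ‖F y‖ ≤ ‖y‖ := fun y => by
    have h1 := F.le_opNorm y
    rw [show ‖F‖ = ‖D‖ from StrongDual.norm_extendRCLike D] at h1
    nlinarith [norm_nonneg y]
  have key : ∀ y, IsParallelPair 𝕜 x y → ‖F y‖ = ‖y‖ := by
    rintro y ⟨c, hc, h⟩
    refine le_antisymm (hF y) ?_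
    -- Equality in the triangle inequality makes the norm affine along the segment, so its slope at
    -- `x` is `‖y‖`.
    have hline : ∀ t ∈ Set.Icc (0 : ℝ) 1, ‖x + t • (c • y)‖ = ‖x‖ + t * ‖y‖ := by
      rintro t ⟨h0, h1⟩
      have hcy : ‖c • y‖ = ‖y‖ := by rw [norm_smul, hc, one_mul]
      apply le_antisymm
      · refine (norm_add_le _ _).trans ?_
        rw [norm_smul, hcy, Real.norm_of_nonneg h0]
      · have h2 : ‖x + c • y‖ ≤ ‖x + t • (c • y)‖ + (1 - t) * ‖y‖ := by
          calc ‖x + c • y‖ = ‖(x + t • (c • y)) + (1 - t) • (c • y)‖ := by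
                congr 1; rw [sub_smul, one_smul]; abel
            _ ≤ _ := (norm_add_le _ _).trans (by
                rw [norm_smul (1 - t), hcy, Real.norm_of_nonneg (by linarith)])
        linarith
    have hder : HasDerivWithinAt (fun t : ℝ => ‖x + t • (c • y)‖) (D (c • y)) (Set.Icc 0 1) 0 := by
      have h1 : HasFDerivAt (fun y : X => ‖y‖) D (x + (0 : ℝ) • (c • y)) := by
        rw [zero_smul, add_zero]; exact hx.hasFDerivAt
      have h2 : HasDerivAt (fun t : ℝ => x + t • (c • y)) (c • y) 0 := by
        simpa using ((hasDerivAt_id (0 : ℝ)).smul_const (c • y)).const_add x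
      exact (h1.comp_hasDerivAt (0 : ℝ) h2).hasDerivWithinAt
    have hder' : HasDerivWithinAt (fun t : ℝ => ‖x + t • (c • y)‖) ‖y‖ (Set.Icc 0 1) 0 := by
      have h2 : HasDerivAt (fun t : ℝ => ‖x‖ + t * ‖y‖) ‖y‖ 0 := by
        simpa using ((hasDerivAt_id (0 : ℝ)).mul_const ‖y‖).const_add ‖x‖
      exact h2.hasDerivWithinAt.congr hline (hline 0 (by simp))
    have heq : D (c • y) = ‖y‖ :=
      ((uniqueDiffOn_Icc zero_lt_one) 0 (by simp)).eq_deriv _ hder hder'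
    calc ‖y‖ = RCLike.re (F (c • y)) := by
          rw [← heq]; exact (StrongDual.re_extendRCLike_apply D _).symm
      _ ≤ ‖F (c • y)‖ := RCLike.re_le_norm _
      _ = ‖F y‖ := by rw [map_smul, norm_smul, hc, one_mul]
  refine ⟨F.toLinearMap, ?_, x, key⟩
  have hxx : ‖F x‖ = ‖x‖ := key x ⟨1, by simp, by
    rw [one_smul, ← two_smul ℝ x, norm_smul]; norm_num; ring⟩
  have h1 : ‖F x‖ ≤ ‖F v‖ + ‖v - x‖ := by
    calc ‖F x‖ = ‖F v - F (v - x)‖ := by rw [← map_sub]; congr 2; abel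
      _ ≤ ‖F v‖ + ‖F (v - x)‖ := norm_sub_le _ _
      _ ≤ _ := by gcongr; exact hF _
  have h2 : ‖v‖ ≤ ‖x‖ + ‖v - x‖ := by
    calc ‖v‖ = ‖x + (v - x)‖ := by congr 1; abel
      _ ≤ _ := norm_add_le _ _
  have : 0 < ‖F v‖ := by linarith
  exact norm_pos_iff.mp this

/-- The image of `y` is parallel to the whole range of `T`. -/
def IsUniversal (T : X →ₗ[𝕜] X) (y : X) : Prop :=
  ∀ x, IsParallelPair 𝕜 (T x) (T y)

/-- A family of functionals which separates points modulo the kernel of `T`, and whose members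
all compute `‖T y‖` at universal `y`. -/
structure IsTestFamily (T : X →ₗ[𝕜] X) (Φ : Set (X →ₗ[𝕜] 𝕜)) : Prop where
  norm_eq : ∀ φ ∈ Φ, ∀ y, IsUniversal T y → ‖φ y‖ = ‖T y‖
  eq_zero : ∀ φ ∈ Φ, ∀ y, T y = 0 → φ y = 0
  sep : ∀ y, (∀ φ ∈ Φ, φ y = 0) → T y = 0

/-- Smooth points are taken in the range of `T`, not in `X`: universality only concerns vectors
parallel to that range. -/
theorem exists_isTestFamily [FiniteDimensional 𝕜 X] (T : X →ₗ[𝕜] X) :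
    ∃ Φ, IsTestFamily T Φ := by
  refine ⟨{φ | (∀ y, IsUniversal T y → ‖φ y‖ = ‖T y‖) ∧ ∀ y, T y = 0 → φ y = 0},
    fun φ h => h.1, fun φ h => h.2, fun y h => ?_⟩
  by_contra hy
  obtain ⟨F, hF, x, hx⟩ := exists_functional_norm_eq_of_parallel (𝕜 := 𝕜) (T.rangeRestrict y)
    (fun h => hy (congrArg Subtype.val h))
  refine hF (h (F ∘ₗ T.rangeRestrict) ⟨fun z hz => ?_, fun z hz => ?_⟩)
  · obtain ⟨x', hx'⟩ := T.surjective_rangeRestrict x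
    subst hx'
    obtain ⟨c, hc, h⟩ := hz x'
    exact hx (T.rangeRestrict z) ⟨c, hc, h⟩
  · have : T.rangeRestrict z = 0 := Subtype.ext hz
    simp [this]

theorem rank_le_one_of_ker_le (T : X →ₗ[𝕜] X) (φ : X →ₗ[𝕜] 𝕜)
    (h : ∀ x, φ x = 0 → T x = 0) : T.rank ≤ 1 := by
  refine rank_le_one_iff.mpr ?_
  by_cases h0 : φ = 0
  · refine ⟨0, ?_⟩
    rintro ⟨_, x, rfl⟩
    exact ⟨0, Subtype.ext (by simp [h x (by simp [h0])])⟩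
  · obtain ⟨x₀, hx₀⟩ : ∃ x, φ x ≠ 0 := by
      by_contra! hh; exact h0 (LinearMap.ext hh)
    refine ⟨T.rangeRestrict x₀, ?_⟩
    rintro ⟨_, x, rfl⟩
    refine ⟨φ x / φ x₀, Subtype.ext ?_⟩
    have := h (x - (φ x / φ x₀) • x₀) (by simp [hx₀])
    rw [map_sub, map_smul, sub_eq_zero] at this
    exact this.symm

theorem PreservesTEAPairs.preservesParallelPairs {T : X →ₗ[𝕜] X} (h : PreservesTEAPairs T) :
    PreservesParallelPairs T := by
  rintro x y ⟨c, hc, hxy⟩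
  have h1 : ‖T x + T (c • y)‖ = ‖T x‖ + ‖T (c • y)‖ := h x (c • y) (by
    simpa [IsTEAPair, norm_smul, hc] using hxy)
  exact ⟨c, hc, by simpa [norm_smul, hc] using h1⟩

theorem IsScalarMultipleOfIsometry.preservesTEAPairs {T : X →ₗ[𝕜] X}
    (h : IsScalarMultipleOfIsometry T) : PreservesTEAPairs T := by
  obtain ⟨c, U, rfl⟩ := h
  intro x y hxy
  have h1 : ∀ z, ‖(c • U.toLinearMap) z‖ = ‖c‖ * ‖z‖ := fun z => by simp [norm_smul]
  unfold IsTEAPair at *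
  rw [← map_add, h1, h1, h1, hxy, mul_add]

theorem IsScalarMultipleOfIsometry.isUnit [FiniteDimensional 𝕜 X] {T : X →ₗ[𝕜] X}
    (h : IsScalarMultipleOfIsometry T) (hT : T ≠ 0) : IsUnit T := by
  obtain ⟨c, U, rfl⟩ := h
  have hc : c ≠ 0 := by rintro rfl; simp at hT
  rw [LinearMap.isUnit_iff_ker_eq_bot, LinearMap.ker_eq_bot']
  intro x hx
  have : U x = 0 := by simpa [hc] using hx
  exact (map_eq_zero_iff U U.injective).mp this

/-- A unimodular multiple of `y` aligned with `x`. -/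
theorem exists_norm_one_norm_add_mul (x y : 𝕜) : ∃ c : 𝕜, ‖c‖ = 1 ∧ ‖x + c * y‖ = ‖x‖ + ‖y‖ := by
  obtain ⟨a, ha, hx⟩ := RCLike.exists_norm_mul_eq_self x
  obtain ⟨b, hb, hy⟩ := RCLike.exists_norm_eq_mul_self y
  refine ⟨a * b, by simp [ha, hb], ?_⟩
  rw [mul_assoc, ← hy]
  nth_rw 1 [← hx]
  rw [← mul_add, norm_mul, ha, one_mul, ← RCLike.ofReal_add, RCLike.norm_ofReal,
    abs_of_nonneg (by positivity)]

theorem norm_add_sq_rclike (a b : 𝕜) :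
    ‖a + b‖ ^ 2 = ‖a‖ ^ 2 + ‖b‖ ^ 2 + 2 * RCLike.re (conj a * b) := by
  have h : ∀ z : 𝕜, ‖z‖ ^ 2 = RCLike.re z ^ 2 + RCLike.im z ^ 2 := fun z => by
    rw [RCLike.norm_sq_eq_def]; ring
  rw [h, h, h]
  simp [RCLike.mul_re]
  ring

/-- Polarization: `u = ±1` determines the real part and `u = I`, when present, the imaginary part.
-/
theorem conj_mul_eq_of_norm_add_eq {a b a' b' : 𝕜}
    (h : ∀ u : 𝕜, ‖u‖ = 1 → ‖a + u * b‖ = ‖a' + u * b'‖) :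
    conj a * b = conj a' * b' ∧ ‖a‖ ^ 2 + ‖b‖ ^ 2 = ‖a'‖ ^ 2 + ‖b'‖ ^ 2 := by
  have h' : ∀ u : 𝕜, ‖u‖ = 1 → ‖a‖ ^ 2 + ‖b‖ ^ 2 + 2 * RCLike.re (u * (conj a * b)) =
      ‖a'‖ ^ 2 + ‖b'‖ ^ 2 + 2 * RCLike.re (u * (conj a' * b')) := fun u hu => by
    have := congrArg (· ^ 2) (h u hu)
    simp only [norm_add_sq_rclike, norm_mul, hu, one_mul] at this
    rwa [mul_left_comm, mul_left_comm _ u] at this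
  have h1 := h' 1 (by simp)
  have h2 := h' (-1) (by simp)
  simp only [one_mul, neg_mul, map_neg] at h1 h2
  refine ⟨RCLike.ext (by linarith) ?_, by linarith⟩
  obtain hI | hI := RCLike.I_eq_zero_or_im_I_eq_one (K := 𝕜)
  · have : ∀ z : 𝕜, RCLike.im z = 0 := fun z => by
      have := RCLike.re_add_im z
      rw [hI, mul_zero, add_zero] at this
      rw [← this, RCLike.ofReal_im]
    rw [this, this]
  · have h3 := h' RCLike.I (RCLike.norm_I_of_ne_zero (by rintro h; simp [h] at hI))
    rw [RCLike.I_mul_re, RCLike.I_mul_re] at h3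
    linarith

end General

/-- Arrays with rows indexed by `ι` and columns by `κ`, normed by the largest `ℓ₁` norm of a
row. -/
abbrev RowSpace (𝕜 ι κ : Type*) := ι → PiLp 1 (fun _ : κ => 𝕜)

/-! ### Universal arrays, and why no single-row array is killed -/

namespace RowSpace

variable {𝕜 : Type*} [RCLike 𝕜] {ι κ : Type*}

section Basic

variable [DecidableEq κ]

/-- The array with the entry `c` at `(i, j)` and zeros elsewhere. -/
noncomputable def cell [DecidableEq ι] (i : ι) (j : κ) (c : 𝕜) : RowSpace 𝕜 ι κ :=
  Pi.single i (PiLp.single 1 j c)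

/-- The array whose row `i` has the single entry `u i` in column `s i`. -/
noncomputable def vertex (s : ι → κ) (u : ι → 𝕜) : RowSpace 𝕜 ι κ :=
  fun i => PiLp.single 1 (s i) (u i)

variable [DecidableEq ι]

theorem cell_apply_same (i : ι) (j : κ) (c : 𝕜) : cell i j c i = PiLp.single 1 j c := by
  simp [cell]

theorem cell_apply_of_ne {i i' : ι} (h : i' ≠ i) (j : κ) (c : 𝕜) : cell i j c i' = 0 := by
  simp [cell, h]

theorem cell_eq_smul (i : ι) (j : κ) (c : 𝕜) : cell i j c = c • cell (ι := ι) i j (1 : 𝕜) := by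
  ext i' j'
  by_cases h : i' = i
  · subst h; simp [cell_apply_same, PiLp.single_apply]
  · simp [cell_apply_of_ne h]

theorem cell_ne_zero (i : ι) (j : κ) {c : 𝕜} (hc : c ≠ 0) : cell (ι := ι) i j c ≠ 0 := by
  simpa [cell] using hc

theorem row_eq_sum [Fintype κ] (v : PiLp 1 (fun _ : κ => 𝕜)) :
    v = ∑ j, PiLp.single 1 j (v j) := by
  ext j
  simp

theorem single_eq_sum [Fintype κ] (i : ι) (v : PiLp 1 (fun _ : κ => 𝕜)) :
    (Pi.single i v : RowSpace 𝕜 ι κ) = ∑ j, v j • cell i j (1 : 𝕜) := by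
  conv_lhs => rw [row_eq_sum v]
  rw [← LinearMap.single_apply (R := 𝕜) (φ := fun _ : ι => PiLp 1 (fun _ : κ => 𝕜)), map_sum]
  refine Finset.sum_congr rfl fun j _ => ?_
  rw [← cell_eq_smul]; rfl

omit [DecidableEq κ] in
theorem exists_eq_single_add (x : RowSpace 𝕜 ι κ) (i : ι) :
    ∃ e : RowSpace 𝕜 ι κ, e i = 0 ∧ x = Pi.single i (x i) + e := by
  refine ⟨Function.update x i 0, by simp, ?_⟩
  ext i' : 1
  by_cases h : i' = i
  · subst h; simp
  · simp [h]

omit [DecidableEq κ] in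
theorem eq_sum_single [Fintype ι] (x : RowSpace 𝕜 ι κ) :
    x = ∑ i, (Pi.single i (x i) : RowSpace 𝕜 ι κ) :=
  (Finset.univ_sum_single x).symm

theorem eq_sum_cell [Fintype ι] [Fintype κ] (x : RowSpace 𝕜 ι κ) :
    x = ∑ i, ∑ j, x i j • cell i j (1 : 𝕜) := by
  conv_lhs => rw [eq_sum_single x]
  exact Finset.sum_congr rfl fun i _ => single_eq_sum i (x i)

end Basic

variable [Fintype ι] [Fintype κ]

theorem exists_norm_row_eq [Nonempty ι] (x : RowSpace 𝕜 ι κ) : ∃ i, ‖x i‖ = ‖x‖ := by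
  obtain ⟨i, -, hi⟩ := Finset.exists_max_image Finset.univ (fun i => ‖x i‖) Finset.univ_nonempty
  exact ⟨i, le_antisymm (norm_le_pi_norm x i)
    ((pi_norm_le_iff_of_nonneg (norm_nonneg _)).mpr fun j => hi j (Finset.mem_univ j))⟩

variable [DecidableEq κ]

theorem norm_row_add_single (v : PiLp 1 (fun _ : κ => 𝕜)) (j : κ) (c : 𝕜)
    (h : ‖v j + c‖ = ‖v j‖ + ‖c‖) : ‖v + PiLp.single 1 j c‖ = ‖v‖ + ‖c‖ := by
  simp only [PiLp.norm_eq_of_L1]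
  rw [← Finset.add_sum_erase _ _ (Finset.mem_univ j),
    ← Finset.add_sum_erase _ (fun i => ‖v i‖) (Finset.mem_univ j)]
  rw [Finset.sum_congr rfl (g := fun i => ‖v i‖) (fun i hi => by
    simp [Finset.ne_of_mem_erase hi])]
  simp only [PiLp.add_apply, PiLp.single_eq_same, h]
  ring

/-- A single entry can be rotated to align with the corresponding entry of `z`, so the norms add in
row `i`, where both arrays attain their norm. -/
theorem isParallelPair_of_row_eq_single {y z : RowSpace 𝕜 ι κ} {i : ι} {j : κ} {c : 𝕜}
    (hy : y i = PiLp.single 1 j c) (hyn : ‖y i‖ = ‖y‖) (hzn : ‖z i‖ = ‖z‖) :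
    IsParallelPair 𝕜 z y := by
  obtain ⟨a, ha, h⟩ := exists_norm_one_norm_add_mul (z i j) c
  refine ⟨a, ha, le_antisymm ?_ ?_⟩
  · simpa [norm_smul, ha] using norm_add_le z (a • y)
  · refine le_trans (le_of_eq ?_) (norm_le_pi_norm (z + a • y) i)
    have h1 : (z + a • y) i = z i + PiLp.single 1 j (a * c) := by
      ext j'
      simp [hy, PiLp.single_apply]
    rw [h1, norm_row_add_single _ _ _ (by rw [h, norm_mul, ha, one_mul]), ← hzn, ← hyn, hy,
      PiLp.norm_single, norm_mul, ha, one_mul]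

omit [Fintype ι] in
theorem norm_vertex_row (s : ι → κ) {u : ι → 𝕜} (hu : ∀ i, ‖u i‖ = 1) (i : ι) :
    ‖vertex s u i‖ = 1 := by
  simp [vertex, PiLp.norm_single, hu]

theorem norm_vertex [Nonempty ι] (s : ι → κ) {u : ι → 𝕜} (hu : ∀ i, ‖u i‖ = 1) :
    ‖vertex s u‖ = 1 := by
  obtain ⟨i, hi⟩ := exists_norm_row_eq (vertex s u)
  rw [← hi, norm_vertex_row s hu]

variable {T : RowSpace 𝕜 ι κ →ₗ[𝕜] RowSpace 𝕜 ι κ} {Φ : Set (RowSpace 𝕜 ι κ →ₗ[𝕜] 𝕜)}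

theorem isUniversal_vertex [Nonempty ι] (hT : PreservesParallelPairs T) (s : ι → κ)
    {u : ι → 𝕜} (hu : ∀ i, ‖u i‖ = 1) : IsUniversal T (vertex s u) := by
  intro x
  obtain ⟨i, hi⟩ := exists_norm_row_eq x
  exact hT _ _ (isParallelPair_of_row_eq_single (i := i) rfl
    (by rw [norm_vertex_row s hu, norm_vertex s hu]) hi)

variable [DecidableEq ι]

/-- Adding a large multiple of the killed array to `x` leaves `T x` unchanged and makes row `i`
dominant, so only row `i` of `y` matters. -/
theorem isUniversal_of_map_single_eq_zero (hT : PreservesParallelPairs T) {i : ι}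
    {v : PiLp 1 (fun _ : κ => 𝕜)} (hv : v ≠ 0) (hk : T (Pi.single i v) = 0)
    {y : RowSpace 𝕜 ι κ} {j : κ} {c : 𝕜} (hy : y i = PiLp.single 1 j c) (hyn : ‖y i‖ = ‖y‖) :
    IsUniversal T y := by
  intro x
  -- The factor 2 leaves norm at least `2‖x‖ - ‖x i‖ ≥ ‖x‖` in row `i`.
  set t : 𝕜 := ((2 * ‖x‖ / ‖v‖ : ℝ) : 𝕜) with ht
  set z := x + t • (Pi.single i v : RowSpace 𝕜 ι κ) with hz
  have hTz : T z = T x := by rw [hz, map_add, map_smul, hk, smul_zero, add_zero]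
  have hv' : 0 < ‖v‖ := norm_pos_iff.mpr hv
  have htv : ‖t • v‖ = 2 * ‖x‖ := by
    rw [norm_smul, ht, RCLike.norm_ofReal, abs_of_nonneg (by positivity)]
    field_simp
  have hzi : z i = x i + t • v := by simp [hz]
  have hge : ‖x‖ ≤ ‖z i‖ := by
    have h1 : ‖t • v‖ ≤ ‖z i‖ + ‖x i‖ := by
      calc ‖t • v‖ = ‖z i - x i‖ := by rw [hzi]; congr 1; abel
        _ ≤ _ := norm_sub_le _ _
    have h2 := norm_le_pi_norm x i
    linarith
  rw [← hTz]
  refine hT _ _ (isParallelPair_of_row_eq_single hy hyn (le_antisymm (norm_le_pi_norm z i) ?_))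
  refine (pi_norm_le_iff_of_nonneg (norm_nonneg _)).mpr fun i' => ?_
  by_cases h : i' = i
  · rw [h]
  · have : z i' = x i' := by simp [hz, h]
    rw [this]
    exact (norm_le_pi_norm x i').trans hge

/-- The other rows of a universal array are now arbitrary of norm at most one. Polarization makes
any two test functionals proportional, with `d` fixing the unimodular ratio. -/
theorem rank_le_one_of_map_single_eq_zero_of_exists (hT : PreservesParallelPairs T)
    (hΦ : IsTestFamily T Φ) {i : ι} {v : PiLp 1 (fun _ : κ => 𝕜)} (hv : v ≠ 0)
    (hk : T (Pi.single i v) = 0) {d : RowSpace 𝕜 ι κ} (hd : d i = 0) (hTd : T d ≠ 0) :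
    T.rank ≤ 1 := by
  have huniv : ∀ (j : κ) (e : RowSpace 𝕜 ι κ), e i = 0 → ‖e‖ ≤ 1 →
      IsUniversal T (cell i j 1 + e) := by
    intro j e he hn
    have hrow : (cell i j (1 : 𝕜) + e) i = PiLp.single 1 j 1 := by
      rw [Pi.add_apply, he, add_zero, cell_apply_same]
    refine isUniversal_of_map_single_eq_zero hT hv hk hrow
      (le_antisymm (norm_le_pi_norm _ i) ?_)
    rw [hrow, PiLp.norm_single, norm_one]
    refine (pi_norm_le_iff_of_nonneg zero_le_one).mpr fun i' => ?_
    by_cases h : i' = i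
    · rw [h, hrow, PiLp.norm_single, norm_one]
    · rw [Pi.add_apply, cell_apply_of_ne h, zero_add]
      exact (norm_le_pi_norm e i').trans hn
  have hconst : ∀ φ ∈ Φ, ∀ ψ ∈ Φ, ∀ e : RowSpace 𝕜 ι κ, e i = 0 → ∀ j,
      conj (φ (cell i j 1)) * φ e = conj (ψ (cell i j 1)) * ψ e ∧ ‖φ e‖ = ‖ψ e‖ := by
    intro φ hφ ψ hψ e he j
    -- Shrinks `e` into the unit ball, so that row `i` still attains the norm.
    set r : ℝ := 1 / (1 + ‖e‖) with hr
    have hr0 : 0 < r := by positivity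
    have hre : ‖(r : 𝕜) • e‖ ≤ 1 := by
      rw [norm_smul, RCLike.norm_ofReal, abs_of_pos hr0, hr, div_mul_eq_mul_div, one_mul,
        div_le_one (by positivity)]
      linarith
    have h := conj_mul_eq_of_norm_add_eq (𝕜 := 𝕜) (a := φ (cell i j 1)) (b := φ ((r : 𝕜) • e))
      (a' := ψ (cell i j 1)) (b' := ψ ((r : 𝕜) • e)) (fun u hu => by
        have hU := huniv j (u • (r : 𝕜) • e) (by simp [he]) (by rwa [norm_smul, hu, one_mul])
        have := (hΦ.norm_eq φ hφ _ hU).trans (hΦ.norm_eq ψ hψ _ hU).symm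
        rwa [map_add, map_smul _ u, map_add, map_smul _ u] at this)
    have h0 : ‖φ (cell i j 1)‖ = ‖ψ (cell i j 1)‖ := by
      have hU := huniv j 0 rfl (by simp)
      rw [add_zero] at hU
      exact (hΦ.norm_eq φ hφ _ hU).trans (hΦ.norm_eq ψ hψ _ hU).symm
    have hr0' : (r : 𝕜) ≠ 0 := by exact_mod_cast hr0.ne'
    rw [map_smul, map_smul, smul_eq_mul, smul_eq_mul, mul_left_comm, mul_left_comm _ (r : 𝕜),
      mul_right_inj' hr0', norm_mul, norm_mul, h0, RCLike.norm_ofReal, abs_of_pos hr0] at h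
    refine ⟨h.1, ?_⟩
    have h2 := add_left_cancel h.2
    rw [sq_eq_sq₀ (by positivity) (by positivity)] at h2
    exact mul_left_cancel₀ hr0.ne' h2
  obtain ⟨ψ, hψ, hψd⟩ : ∃ ψ ∈ Φ, ψ d ≠ 0 := by
    by_contra! h
    exact hTd (hΦ.sep d h)
  refine rank_le_one_of_ker_le T ψ fun x hx => hΦ.sep x fun φ hφ => ?_
  obtain ⟨c, hc⟩ : ∃ c, φ d = c * ψ d := ⟨φ d / ψ d, by field_simp⟩
  by_cases hκ : Nonempty κ
  swap
  · have : x = 0 := by ext i j; exact (hκ ⟨j⟩).elim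
    simp [this]
  obtain ⟨j₀⟩ := hκ
  have hc1 : ‖c‖ = 1 := by
    have := (hconst φ hφ ψ hψ d hd j₀).2
    rw [hc, norm_mul] at this
    exact mul_right_cancel₀ (norm_ne_zero_iff.mpr hψd) (this.trans (one_mul _).symm)
  have hcc : c * conj c = 1 := by rw [RCLike.mul_conj, hc1]; simp
  have hcell : ∀ j, φ (cell i j 1) = c * ψ (cell i j 1) := fun j => by
    have := (hconst φ hφ ψ hψ d hd j).1
    rw [hc, ← mul_assoc, mul_left_inj' hψd] at this
    have h2 := congrArg conj this
    rw [map_mul, RCLike.conj_conj, RCLike.conj_conj] at h2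
    rw [← h2, mul_left_comm, hcc, mul_one]
  have hrest : ∀ e : RowSpace 𝕜 ι κ, e i = 0 → φ e = c * ψ e := fun e he => by
    have := (conj_mul_eq_of_norm_add_eq (𝕜 := 𝕜) (a := φ d) (b := φ e) (a' := ψ d) (b' := ψ e)
      (fun u _ => by
        have := (hconst φ hφ ψ hψ (d + u • e) (by simp [hd, he]) j₀).2
        simpa using this)).1
    have hd' : conj (ψ d) ≠ 0 := by simpa using hψd
    rw [hc, map_mul, mul_comm (conj c), mul_assoc, mul_right_inj' hd'] at this
    rw [← this, ← mul_assoc, hcc, one_mul]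
  obtain ⟨e, he, hxe⟩ := exists_eq_single_add x i
  rw [single_eq_sum] at hxe
  have : φ x = c * ψ x := by
    rw [hxe, map_add, map_add, hrest e he, mul_add, map_sum, map_sum, Finset.mul_sum]
    congr 1
    refine Finset.sum_congr rfl fun j _ => ?_
    rw [map_smul, map_smul, hcell, smul_eq_mul, smul_eq_mul, mul_left_comm]
  rw [this, hx, mul_zero]

theorem rank_le_one_of_map_single_eq_zero [Nontrivial ι] (hT : PreservesParallelPairs T)
    (hΦ : IsTestFamily T Φ) {i : ι} {v : PiLp 1 (fun _ : κ => 𝕜)} (hv : v ≠ 0)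
    (hk : T (Pi.single i v) = 0) : T.rank ≤ 1 := by
  by_contra hrank
  have h1 : ∀ d : RowSpace 𝕜 ι κ, d i = 0 → T d = 0 := fun d hd => by
    by_contra hTd
    exact hrank (rank_le_one_of_map_single_eq_zero_of_exists hT hΦ hv hk hd hTd)
  obtain ⟨i', hi'⟩ := exists_ne i
  -- By `h1`, row `i'` also contains a killed nonzero array, so the same argument applies there and
  -- `T` vanishes.
  have h2 : ∀ d : RowSpace 𝕜 ι κ, d i' = 0 → T d = 0 := fun d hd => by
    by_contra hTd
    exact hrank (rank_le_one_of_map_single_eq_zero_of_exists hT hΦ hv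
      (h1 (Pi.single i' v) (by simp [hi'.symm])) hd hTd)
  refine hrank (rank_le_one_of_ker_le T 0 fun x _ => ?_)
  obtain ⟨e, he, hxe⟩ := exists_eq_single_add x i
  rw [hxe, map_add, h1 e he, h2 _ (by simp [hi']), add_zero]

end RowSpace

/-! ### Test functionals live on one row -/

namespace RowSpace

variable {𝕜 : Type*} [RCLike 𝕜] {ι κ : Type*} [Fintype ι] [Fintype κ] [DecidableEq ι]
  [DecidableEq κ]
variable {T : RowSpace 𝕜 ι κ →ₗ[𝕜] RowSpace 𝕜 ι κ} {Φ : Set (RowSpace 𝕜 ι κ →ₗ[𝕜] 𝕜)}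

omit [Fintype ι] in
theorem map_single_eq_sum (φ : RowSpace 𝕜 ι κ →ₗ[𝕜] 𝕜) (i : ι)
    (v : PiLp 1 (fun _ : κ => 𝕜)) : φ (Pi.single i v) = ∑ j, φ (cell i j 1) * v j := by
  rw [single_eq_sum, map_sum]
  exact Finset.sum_congr rfl fun j _ => by rw [map_smul, smul_eq_mul, mul_comm]

omit [Fintype κ] [DecidableEq κ] in
theorem map_eq_sum_single (φ : RowSpace 𝕜 ι κ →ₗ[𝕜] 𝕜) (x : RowSpace 𝕜 ι κ) :
    φ x = ∑ i, φ (Pi.single i (x i)) := by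
  conv_lhs => rw [eq_sum_single x, map_sum]

theorem map_eq_sum_of_row {φ : RowSpace 𝕜 ι κ →ₗ[𝕜] 𝕜} {i : ι}
    (h : ∀ i' ≠ i, ∀ j, φ (cell i' j 1) = 0) (x : RowSpace 𝕜 ι κ) :
    φ x = ∑ j, φ (cell i j 1) * x i j := by
  rw [map_eq_sum_single, Finset.sum_eq_single i, map_single_eq_sum]
  · intro i' _ hi'
    rw [map_single_eq_sum]
    exact Finset.sum_eq_zero fun j _ => by rw [h i' hi', zero_mul]
  · simp

theorem conj_map_cell_mul_map_cell_eq [Nonempty ι] (hT : PreservesParallelPairs T)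
    (hΦ : IsTestFamily T Φ) {φ ψ : RowSpace 𝕜 ι κ →ₗ[𝕜] 𝕜} (hφ : φ ∈ Φ) (hψ : ψ ∈ Φ)
    {i i' : ι} (hi : i ≠ i') (j j' : κ) :
    conj (φ (cell i j 1)) * φ (cell i' j' 1) = conj (ψ (cell i j 1)) * ψ (cell i' j' 1) := by
  set r : RowSpace 𝕜 ι κ := fun k => if k = i ∨ k = i' then 0 else PiLp.single 1 j 1 with hr
  have huniv : ∀ a b : 𝕜, ‖a‖ = 1 → ‖b‖ = 1 →
      IsUniversal T ((r + a • cell i j 1) + b • cell i' j' 1) := by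
    intro a b ha hb
    have := isUniversal_vertex hT (fun k => if k = i' then j' else j)
      (u := fun k => if k = i then a else if k = i' then b else 1)
      (fun k => by split_ifs <;> simp [ha, hb])
    convert this using 1
    ext k l
    by_cases h1 : k = i
    · subst h1
      simp [hr, vertex, cell_apply_same, cell_apply_of_ne hi, hi, PiLp.single_apply]
    · by_cases h2 : k = i'
      · subst h2
        simp [hr, vertex, cell_apply_same, cell_apply_of_ne h1, h1, PiLp.single_apply]
      · simp [hr, vertex, cell_apply_of_ne h1, cell_apply_of_ne h2, h1, h2]
  have key : ∀ a : 𝕜, ‖a‖ = 1 → conj (φ (r + a • cell i j 1)) * φ (cell i' j' 1) =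
      conj (ψ (r + a • cell i j 1)) * ψ (cell i' j' 1) := fun a ha =>
    (conj_mul_eq_of_norm_add_eq fun u hu => by
      have hU := huniv a u ha hu
      have := (hΦ.norm_eq φ hφ _ hU).trans (hΦ.norm_eq ψ hψ _ hU).symm
      rwa [map_add φ (r + _), map_add ψ (r + _), map_smul φ u, map_smul ψ u] at this).1
  -- Subtracting the cases `a = 1` and `a = -1` removes the contribution of the remaining rows `r`.
  have h1 := key 1 (by simp)
  have h2 := key (-1) (by simp)
  simp only [map_add, map_smul, smul_eq_mul, map_mul, map_neg, map_one, one_mul] at h1 h2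
  linear_combination (h1 - h2) / 2

/-- If `φ` were nonzero on two rows, the equal products would make all test functionals proportional
to `φ` on row `i'`. The two-entry vector `v` there, annihilated by `φ`, would be annihilated by all
of them, hence by `T`. -/
theorem map_cell_eq_zero_or [Nontrivial κ] (hT : PreservesParallelPairs T)
    (hΦ : IsTestFamily T Φ) (hrow : ∀ i (v : PiLp 1 (fun _ : κ => 𝕜)), T (Pi.single i v) = 0 → v = 0)
    {φ : RowSpace 𝕜 ι κ →ₗ[𝕜] 𝕜} (hφ : φ ∈ Φ) {i i' : ι} (hi : i ≠ i') (j j' : κ) :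
    φ (cell i j 1) = 0 ∨ φ (cell i' j' 1) = 0 := by
  have : Nonempty ι := ⟨i⟩
  by_contra! h
  obtain ⟨l, hl⟩ := exists_ne j'
  set v : PiLp 1 (fun _ : κ => 𝕜) :=
    PiLp.single 1 l (φ (cell i' j' 1)) - PiLp.single 1 j' (φ (cell i' l 1)) with hv
  have hv0 : v ≠ 0 := fun h0 => h.2 (by
    have := congrArg (fun w : PiLp 1 (fun _ : κ => 𝕜) => w l) h0
    simpa [hv, PiLp.single_apply, hl] using this)
  have hval : ∀ ψ : RowSpace 𝕜 ι κ →ₗ[𝕜] 𝕜, ψ (Pi.single i' v) =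
      φ (cell i' j' 1) * ψ (cell i' l 1) - φ (cell i' l 1) * ψ (cell i' j' 1) := fun ψ => by
    have : (Pi.single i' v : RowSpace 𝕜 ι κ) =
        cell i' l (φ (cell i' j' 1)) - cell i' j' (φ (cell i' l 1)) := by
      simp [cell, hv, Pi.single_sub]
    rw [this, cell_eq_smul, cell_eq_smul i' j' (φ _), map_sub, map_smul, map_smul]; rfl
  refine hv0 (hrow i' v (hΦ.sep _ fun ψ hψ => ?_))
  have h1 := conj_map_cell_mul_map_cell_eq hT hΦ hψ hφ hi j j'
  have h2 := conj_map_cell_mul_map_cell_eq hT hΦ hψ hφ hi j l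
  have h3 : conj (ψ (cell i j 1)) ≠ 0 := by
    intro h0
    rw [h0, zero_mul, eq_comm, mul_eq_zero] at h1
    exact h1.elim (fun h1 => h.1 (by simpa using h1)) h.2
  rw [hval]
  apply mul_left_cancel₀ h3
  linear_combination φ (cell i' j' 1) * h2 - φ (cell i' l 1) * h1

theorem injective_of_isTestFamily [Nontrivial κ] (hT : PreservesParallelPairs T)
    (hΦ : IsTestFamily T Φ)
    (hrow : ∀ i (v : PiLp 1 (fun _ : κ => 𝕜)), T (Pi.single i v) = 0 → v = 0) :
    Function.Injective T := by
  rw [← LinearMap.ker_eq_bot, LinearMap.ker_eq_bot']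
  intro x hx
  ext i : 1
  refine hrow i (x i) (hΦ.sep _ fun φ hφ => ?_)
  by_cases h : ∀ j, φ (cell i j 1) = 0
  · rw [map_single_eq_sum]
    exact Finset.sum_eq_zero fun j _ => by rw [h, zero_mul]
  · push Not at h
    obtain ⟨j, hj⟩ := h
    rw [map_single_eq_sum, ← map_eq_sum_of_row (fun i' hi' j' =>
      (map_cell_eq_zero_or hT hΦ hrow hφ hi' j' j).resolve_right hj) x]
    exact hΦ.eq_zero φ hφ x hx

/-- The pairing of the row `i` with the coefficients `u`. -/
noncomputable def rowFunctional (i : ι) (u : κ → 𝕜) : RowSpace 𝕜 ι κ →ₗ[𝕜] 𝕜 where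
  toFun x := ∑ j, u j * x i j
  map_add' x y := by simp [mul_add, Finset.sum_add_distrib]
  map_smul' c x := by simp [Finset.mul_sum, mul_left_comm]

omit [Fintype ι] [DecidableEq ι] [DecidableEq κ] in
theorem rowFunctional_apply (i : ι) (u : κ → 𝕜) (x : RowSpace 𝕜 ι κ) :
    rowFunctional i u x = ∑ j, u j * x i j := rfl

/-- On a vertex, a functional living on row `i` sees only the entry in that row. Vertices can be
varied independently in two rows, so comparing functionals on different rows equates all coefficient
moduli. -/
theorem exists_eq_smul_rowFunctional [Nontrivial ι] [Nontrivial κ]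
    (hT : PreservesParallelPairs T) (hΦ : IsTestFamily T Φ)
    (hrow : ∀ i (v : PiLp 1 (fun _ : κ => 𝕜)), T (Pi.single i v) = 0 → v = 0) :
    ∃ c : ℝ, 0 < c ∧ ∀ φ ∈ Φ, ∃ i u, (∀ j, ‖u j‖ = 1) ∧ φ = (c : 𝕜) • rowFunctional i u := by
  have hz := fun φ hφ => @map_cell_eq_zero_or 𝕜 _ ι κ _ _ _ _ T Φ _ hT hΦ hrow φ hφ
  have hvert : ∀ φ ∈ Φ, ∀ i j, φ (cell i j 1) ≠ 0 → ∀ s : ι → κ,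
      ‖φ (cell i (s i) 1)‖ = ‖T (vertex s fun _ => 1)‖ := by
    intro φ hφ i j hj s
    rw [← hΦ.norm_eq φ hφ _ (isUniversal_vertex hT s (fun _ => norm_one)),
      map_eq_sum_of_row (fun i' hi' j' => (hz φ hφ hi' j' j).resolve_right hj) (vertex s _)]
    simp [vertex, PiLp.single_apply]
  have hex : ∀ i, ∃ φ ∈ Φ, ∃ j, φ (cell i j 1) ≠ 0 := by
    intro i
    by_contra! h
    obtain ⟨j⟩ := (inferInstance : Nonempty κ)
    have := hrow i (PiLp.single 1 j 1) (hΦ.sep _ fun φ hφ => h φ hφ j)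
    simp at this
  obtain ⟨i₁, i₂, h12⟩ := exists_pair_ne ι
  obtain ⟨φ₁, hφ₁, j₁, hj₁⟩ := hex i₁
  obtain ⟨φ₂, hφ₂, j₂, hj₂⟩ := hex i₂
  set c := ‖φ₁ (cell i₁ j₁ 1)‖ with hc
  have hc0 : 0 < c := norm_pos_iff.mpr hj₁
  have h2 : ∀ j, ‖φ₂ (cell i₂ j 1)‖ = c := fun j => by
    have ha := hvert φ₁ hφ₁ i₁ j₁ hj₁ (fun k => if k = i₁ then j₁ else j)
    have hb := hvert φ₂ hφ₂ i₂ j₂ hj₂ (fun k => if k = i₁ then j₁ else j)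
    rw [← ha] at hb
    simpa [h12.symm] using hb
  have hval : ∀ s : ι → κ, ‖T (vertex s fun _ => 1)‖ = c := fun s => by
    rw [← hvert φ₂ hφ₂ i₂ j₂ hj₂ s, h2]
  refine ⟨c, hc0, fun φ hφ => ?_⟩
  obtain ⟨i, j, hij⟩ : ∃ i j, φ (cell i j 1) ≠ 0 := by
    by_contra! h
    have h0 : φ (vertex (fun _ => j₁) fun _ => 1) = 0 := by
      rw [map_eq_sum_of_row (i := i₁) (fun i _ j => h i j)]
      exact Finset.sum_eq_zero fun j _ => by rw [h, zero_mul]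
    have := hΦ.norm_eq φ hφ _ (isUniversal_vertex hT (fun _ => j₁) (fun _ => norm_one))
    rw [h0, norm_zero, hval] at this
    exact hc0.ne this
  have hcK : (c : 𝕜) ≠ 0 := by exact_mod_cast hc0.ne'
  refine ⟨i, fun j => φ (cell i j 1) / c, fun l => ?_, LinearMap.ext fun x => ?_⟩
  · rw [norm_div, RCLike.norm_ofReal, abs_of_pos hc0, hvert φ hφ i j hij (fun _ => l), hval,
      div_self hc0.ne']
  · rw [map_eq_sum_of_row (fun i' hi' j' => (hz φ hφ hi' j' j).resolve_right hij),
      LinearMap.smul_apply, rowFunctional_apply, Finset.smul_sum]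
    refine Finset.sum_congr rfl fun l _ => ?_
    rw [smul_eq_mul]
    field_simp

end RowSpace

/-! ### Real versus complex scalars -/

section Scalars

variable {𝕜 : Type*} [RCLike 𝕜]

/-- After aligning phases, `w = 1, -1, I` would give three distinct squared moduli. Over the reals
`v = t` is a counterexample. -/
theorem eq_zero_of_norm_add_mul_mem_pair (hI : (RCLike.I : 𝕜) ≠ 0) {v t : 𝕜} (ht : t ≠ 0) {c : ℝ}
    (h : ∀ w : 𝕜, ‖w‖ = 1 → ‖v + w * t‖ = 0 ∨ ‖v + w * t‖ = c) : v = 0 := by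
  by_contra hv
  obtain ⟨a, ha, haz⟩ := RCLike.exists_norm_eq_mul_self (conj v * t)
  have hpos : 0 < ‖conj v * t‖ := norm_pos_iff.mpr (mul_ne_zero (by simpa using hv) ht)
  set r := ‖conj v * t‖ with hr
  have hsq : ∀ w : 𝕜, ‖w‖ = 1 → ‖v + w * a * t‖ ^ 2 = ‖v‖ ^ 2 + ‖t‖ ^ 2 +
      2 * RCLike.re (w * (r : 𝕜)) := fun w hw => by
    have hassoc : conj v * (w * a * t) = w * (a * (conj v * t)) := by ring
    rw [norm_add_sq_rclike, hassoc, ← haz, norm_mul, norm_mul, hw, ha, one_mul, one_mul]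
  have hmem : ∀ w : 𝕜, ‖w‖ = 1 → ‖v‖ ^ 2 + ‖t‖ ^ 2 + 2 * RCLike.re (w * (r : 𝕜)) = 0 ∨
      ‖v‖ ^ 2 + ‖t‖ ^ 2 + 2 * RCLike.re (w * (r : 𝕜)) = c ^ 2 := fun w hw => by
    rw [← hsq w hw]
    exact (h (w * a) (by rw [norm_mul, hw, ha, one_mul])).imp
      (fun h => by rw [h]; norm_num) (fun h => by rw [h])
  have h1 := hmem 1 (by simp)
  have h2 := hmem (-1) (by simp)
  have h3 := hmem RCLike.I (RCLike.norm_I_of_ne_zero hI)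
  simp only [one_mul, neg_mul, map_neg, RCLike.ofReal_re, RCLike.I_mul_re, RCLike.ofReal_im] at h1 h2 h3
  rcases h1 with h1 | h1 <;> rcases h2 with h2 | h2 <;> rcases h3 with h3 | h3 <;> linarith

theorem eq_zero_or_eq_zero_of_norm_sum_mem_pair {κ : Type*} [Fintype κ] [DecidableEq κ]
    (hI : (RCLike.I : 𝕜) ≠ 0) {t : κ → 𝕜} {c : ℝ}
    (h : ∀ u : κ → 𝕜, (∀ l, ‖u l‖ = 1) → ‖∑ l, u l * t l‖ = 0 ∨ ‖∑ l, u l * t l‖ = c)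
    {l l' : κ} (hl : l ≠ l') : t l = 0 ∨ t l' = 0 := by
  by_contra! h0
  have key : ∀ u : κ → 𝕜, (∀ l, ‖u l‖ = 1) → ∑ k ∈ Finset.univ.erase l, u k * t k = 0 := by
    intro u hu
    refine eq_zero_of_norm_add_mul_mem_pair hI h0.1 (c := c) fun w hw => ?_
    have := h (Function.update u l w) (fun k => by
      by_cases hk : k = l
      · subst hk; simpa using hw
      · simpa [hk] using hu k)
    rw [← Finset.sum_erase_add _ _ (Finset.mem_univ l), Function.update_self,
      Finset.sum_congr rfl (g := fun k => u k * t k) (fun k hk => by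
        rw [Function.update_of_ne (Finset.ne_of_mem_erase hk)])] at this
    exact this
  have hmem : l' ∈ Finset.univ.erase l := by simp [hl.symm]
  have h1 := key (fun _ => 1) (by simp)
  have h2 := key (Function.update (fun _ => 1) l' (-1)) (fun k => by
      by_cases hk : k = l'
      · subst hk; simp
      · simp [hk])
  rw [← Finset.sum_erase_add _ _ hmem] at h1 h2
  rw [Finset.sum_congr rfl (g := fun k => 1 * t k) (fun k hk => by
        rw [Function.update_of_ne (Finset.ne_of_mem_erase hk)]), Function.update_self] at h2
  have : (2 : 𝕜) * t l' = 0 := by linear_combination h1 - h2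
  exact h0.2 (by simpa using this)

theorem finite_norm_eq_one (hI : (RCLike.I : 𝕜) = 0) : {u : 𝕜 | ‖u‖ = 1}.Finite := by
  refine ((Set.finite_singleton (-1 : 𝕜)).insert 1).subset fun u hu => ?_
  have hre : (RCLike.re u : 𝕜) = u := by
    have := RCLike.re_add_im u
    rwa [hI, mul_zero, add_zero] at this
  rw [Set.mem_ofPred_eq, ← hre, RCLike.norm_ofReal] at hu
  rcases eq_or_eq_neg_of_abs_eq hu with h | h
  · left; rw [← hre, h]; simp
  · right; rw [Set.mem_singleton_iff, ← hre, h]; simp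

end Scalars

/-! ### Extreme functionals and the isometry -/

namespace RowSpace

variable {𝕜 : Type*} [RCLike 𝕜] {ι κ : Type*} [Fintype ι] [Fintype κ]
variable {T : RowSpace 𝕜 ι κ →ₗ[𝕜] RowSpace 𝕜 ι κ}

theorem norm_rowFunctional_le (i : ι) {u : κ → 𝕜} (hu : ∀ j, ‖u j‖ = 1) (x : RowSpace 𝕜 ι κ) :
    ‖rowFunctional i u x‖ ≤ ‖x‖ := by
  refine le_trans ?_ (norm_le_pi_norm x i)
  rw [rowFunctional_apply, PiLp.norm_eq_of_L1]
  refine (norm_sum_le _ _).trans (le_of_eq (Finset.sum_congr rfl fun j _ => ?_))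
  rw [norm_mul, hu, one_mul]

theorem exists_norm_rowFunctional_eq [Nonempty ι] (x : RowSpace 𝕜 ι κ) :
    ∃ (i : ι) (u : κ → 𝕜), (∀ j, ‖u j‖ = 1) ∧ ‖rowFunctional i u x‖ = ‖x‖ := by
  obtain ⟨i, hi⟩ := exists_norm_row_eq x
  choose u hu hux using fun j => RCLike.exists_norm_eq_mul_self (x i j)
  refine ⟨i, u, hu, ?_⟩
  rw [rowFunctional_apply, ← hi, PiLp.norm_eq_of_L1, Finset.sum_congr rfl fun j _ => (hux j).symm,
    ← RCLike.ofReal_sum, RCLike.norm_ofReal, abs_of_nonneg (Finset.sum_nonneg fun j _ => norm_nonneg _)]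

variable [DecidableEq ι]

/-- The sum must attain its norm in row `i`, since the fixed array vanishes elsewhere. Equality in
`ℓ₁` then aligns each entry of that row with `conj (u j)`. -/
theorem norm_rowFunctional_eq_of_isParallelPair [Nonempty κ] {i : ι} {u : κ → 𝕜}
    (hu : ∀ j, ‖u j‖ = 1) {z : RowSpace 𝕜 ι κ}
    (h : IsParallelPair 𝕜 (Pi.single i (WithLp.toLp 1 fun j => conj (u j)) : RowSpace 𝕜 ι κ) z) :
    ‖rowFunctional i u z‖ = ‖z‖ := by
  have : Nonempty ι := ⟨i⟩
  obtain ⟨c, hc, h⟩ := h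
  set y : RowSpace 𝕜 ι κ := Pi.single i (WithLp.toLp 1 fun j => conj (u j)) with hy
  set w := c • z with hw
  have hwz : ‖w‖ = ‖z‖ := by rw [hw, norm_smul, hc, one_mul]
  have hyj : ∀ j, y i j = conj (u j) := fun j => by simp [hy]
  have hyi : ‖y‖ = ‖y i‖ := by rw [hy, Pi.norm_single, Pi.single_eq_same]
  have hypos : 0 < ‖y i‖ := by
    rw [PiLp.norm_eq_of_L1]
    exact Finset.sum_pos (fun j _ => by rw [hyj]; simp [hu]) Finset.univ_nonempty
  rw [← hwz] at h
  obtain ⟨k, hk⟩ := exists_norm_row_eq (y + w)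
  have hki : k = i := by
    by_contra hki
    have h1 : (y + w) k = w k := by simp [hy, hki]
    have h2 := norm_le_pi_norm w k
    rw [h1] at hk
    linarith
  subst hki
  have hwk := norm_le_pi_norm w k
  have htri := norm_add_le (y k) (w k)
  rw [Pi.add_apply] at hk
  have hwn : ‖w k‖ = ‖w‖ := by linarith
  have hsum : ∑ j, ‖y k j + w k j‖ = ∑ j, (‖y k j‖ + ‖w k j‖) := by
    rw [Finset.sum_add_distrib, ← PiLp.norm_eq_of_L1, ← PiLp.norm_eq_of_L1]
    have := PiLp.norm_eq_of_L1 (y k + w k)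
    simp only [PiLp.add_apply] at this
    linarith
  rw [Finset.sum_eq_sum_iff_of_le fun j _ => norm_add_le _ _] at hsum
  have hre : ∀ j, RCLike.re (u j * w k j) = ‖w k j‖ := fun j => by
    have h1 := congrArg (· ^ 2) (hsum j (Finset.mem_univ j))
    simp only [norm_add_sq_rclike] at h1
    rw [hyj, RCLike.conj_conj, RCLike.norm_conj, hu] at h1
    nlinarith
  have hge : ‖w‖ ≤ ‖rowFunctional k u w‖ := by
    refine le_trans (le_of_eq ?_) (RCLike.re_le_norm _)
    rw [rowFunctional_apply, map_sum, ← hwn, PiLp.norm_eq_of_L1]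
    exact Finset.sum_congr rfl fun j _ => (hre j).symm
  have heq : ‖rowFunctional k u w‖ = ‖rowFunctional k u z‖ := by
    rw [hw, map_smul, norm_smul, hc, one_mul]
  rw [← heq, ← hwz]
  exact le_antisymm (norm_rowFunctional_le k hu w) hge

theorem isTestFamily_rowFunctional_comp [Nonempty ι] [Nonempty κ]
    (hT : Function.Surjective T) :
    IsTestFamily T {φ | ∃ i u, (∀ j, ‖u j‖ = 1) ∧ φ = rowFunctional i u ∘ₗ T} := by
  refine ⟨?_, ?_, fun y hy => ?_⟩
  · rintro _ ⟨i, u, hu, rfl⟩ y hy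
    obtain ⟨x, hx⟩ := hT (Pi.single i (WithLp.toLp 1 fun j => conj (u j)))
    refine norm_rowFunctional_eq_of_isParallelPair hu ?_
    rw [← hx]
    exact hy x
  · rintro _ ⟨i, u, hu, rfl⟩ y hy
    simp [hy]
  · obtain ⟨i, u, hu, h⟩ := exists_norm_rowFunctional_eq (T y)
    rw [← norm_eq_zero, ← h, norm_eq_zero]
    exact hy _ ⟨i, u, hu, rfl⟩

variable [DecidableEq κ]

omit [Fintype ι] in
theorem rowFunctional_cell (i i' : ι) (u : κ → 𝕜) (j : κ) :
    rowFunctional i u (cell i' j 1) = if i = i' then u j else 0 := by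
  rw [rowFunctional_apply]
  split_ifs with h
  · subst h
    simp [cell_apply_same, PiLp.single_apply]
  · simp [cell_apply_of_ne h]

omit [Fintype ι] [DecidableEq ι] in
theorem exists_eq_single [Nonempty κ] {w : PiLp 1 (fun _ : κ => 𝕜)}
    (h : ∀ l l', l ≠ l' → w l = 0 ∨ w l' = 0) : ∃ l, w = PiLp.single 1 l (∑ k, w k) := by
  by_cases h0 : ∃ l, w l ≠ 0
  · obtain ⟨l, hl⟩ := h0
    have hz : ∀ k, k ≠ l → w k = 0 := fun k hk => (h k l hk).resolve_right hl
    refine ⟨l, ?_⟩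
    rw [Finset.sum_eq_single l (fun k _ hk => hz k hk) (by simp)]
    ext k
    by_cases hk : k = l
    · subst hk; simp
    · simp [hk, hz k hk]
  · push Not at h0
    obtain ⟨l⟩ := ‹Nonempty κ›
    refine ⟨l, ?_⟩
    ext k
    simp [h0]

/-- Pairing a row of the image of a cell with any unimodular `u` gives modulus `0` or `c`, so that
row has at most one nonzero entry. Thus `T` permutes the cells, up to scalars of modulus `c`. -/
theorem mul_norm_le_norm_map_of_I_ne_zero [Nonempty ι] [Nonempty κ]
    (hI : (RCLike.I : 𝕜) ≠ 0) (hT : Function.Injective T) {c : ℝ} (hc : 0 < c)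
    (h : ∀ i u, (∀ j, ‖u j‖ = 1) → ∃ i' u', (∀ j, ‖u' j‖ = 1) ∧
      rowFunctional i u ∘ₗ T = (c : 𝕜) • rowFunctional i' u') (x : RowSpace 𝕜 ι κ) :
    c * ‖x‖ ≤ ‖T x‖ := by
  choose σ v hv hσ using fun i => h i (fun _ => 1) (fun _ => norm_one)
  have hsum : ∀ i i' j, ∑ l, T (cell i' j 1) i l = if σ i = i' then c * v i j else 0 := by
    intro i i' j
    have := LinearMap.congr_fun (hσ i) (cell i' j 1)
    rw [LinearMap.comp_apply, LinearMap.smul_apply, rowFunctional_cell, rowFunctional_apply] at this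
    simpa using this
  have hex : ∀ i i' j, ∃ l, T (cell i' j 1) i =
      PiLp.single 1 l (if σ i = i' then c * v i j else 0) := by
    intro i i' j
    rw [← hsum]
    refine exists_eq_single fun l l' hl => ?_
    refine eq_zero_or_eq_zero_of_norm_sum_mem_pair hI (c := c) (fun u hu => ?_) hl
    obtain ⟨k, u', hu', hk⟩ := h i u hu
    have := LinearMap.congr_fun hk (cell i' j 1)
    rw [LinearMap.comp_apply, LinearMap.smul_apply, rowFunctional_cell, rowFunctional_apply] at this
    rw [this]
    split_ifs
    · right
      rw [norm_smul, hu', RCLike.norm_ofReal, abs_of_pos hc, mul_one]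
    · left; simp
  choose τ hτ using hex
  have hoff : ∀ i i' j, σ i ≠ i' → T (cell i' j 1) i = 0 := fun i i' j hne => by
    rw [hτ, if_neg hne]; simp
  have hsurj : Function.Surjective σ := by
    intro i'
    by_contra! hno
    obtain ⟨j⟩ := ‹Nonempty κ›
    refine cell_ne_zero (𝕜 := 𝕜) i' j one_ne_zero (hT ?_)
    rw [map_zero]
    ext i : 1
    exact hoff i i' j (hno i)
  have hinj : Function.Injective σ := Finite.injective_iff_surjective.mpr hsurj
  have hcK : (c : 𝕜) ≠ 0 := by exact_mod_cast hc.ne'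
  have hne : ∀ i j, (c : 𝕜) * v i j ≠ 0 := fun i j =>
    mul_ne_zero hcK (norm_ne_zero_iff.mp (by rw [hv]; exact one_ne_zero))
  have hdiag : ∀ i j, T (cell (σ i) j 1) = cell i (τ i (σ i) j) (c * v i j) := fun i j => by
    ext k : 1
    by_cases hk : k = i
    · subst hk
      rw [hτ, if_pos rfl, cell_apply_same]
    · rw [hoff _ _ _ (fun he => hk (hinj he)), cell_apply_of_ne hk]
  -- Two cells sent to the same position would have proportional images, against injectivity of `T`.
  have hτinj : ∀ i, Function.Injective (τ i (σ i)) := by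
    intro i j j' hjj
    by_contra hne'
    have h1 : T ((c * v i j') • cell (σ i) j 1) = T ((c * v i j) • cell (σ i) j' 1) := by
      rw [map_smul, map_smul, hdiag, hdiag, hjj, cell_eq_smul _ _ (_ * v i j),
        cell_eq_smul _ _ (_ * v i j'), smul_comm]
    have h2 := congrArg (fun y : RowSpace 𝕜 ι κ => y (σ i) j) (hT h1)
    simp only [Pi.smul_apply, cell_apply_same, PiLp.smul_apply, PiLp.single_apply, if_neg hne',
      if_true, smul_eq_mul, mul_one, mul_zero] at h2
    exact hne i j' h2
  obtain ⟨k, hk⟩ := exists_norm_row_eq x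
  obtain ⟨i, rfl⟩ := hsurj k
  have hτbij : Function.Bijective (τ i (σ i)) := Finite.injective_iff_bijective.mp (hτinj i)
  have hTx : ∀ j, T x i (τ i (σ i) j) = x (σ i) j * (c * v i j) := by
    intro j
    have : T x i = ∑ j', x (σ i) j' • PiLp.single 1 (τ i (σ i) j') (c * v i j') := by
      conv_lhs => rw [eq_sum_cell x]
      rw [map_sum, Finset.sum_apply, Finset.sum_eq_single (σ i)]
      · rw [map_sum, Finset.sum_apply]
        refine Finset.sum_congr rfl fun j' _ => ?_
        rw [map_smul, hdiag, Pi.smul_apply, cell_apply_same]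
      · intro i' _ hi'
        rw [map_sum, Finset.sum_apply]
        refine Finset.sum_eq_zero fun j' _ => ?_
        rw [map_smul, Pi.smul_apply, hoff _ _ _ hi'.symm, smul_zero]
      · simp
    rw [this]
    simp [Pi.single_apply, (hτinj i).eq_iff]
  calc c * ‖x‖ = ∑ j, ‖T x i (τ i (σ i) j)‖ := by
        rw [← hk, PiLp.norm_eq_of_L1, Finset.mul_sum]
        refine Finset.sum_congr rfl fun j _ => ?_
        rw [hTx, norm_mul, norm_mul, hv, RCLike.norm_ofReal, abs_of_pos hc, mul_one, mul_comm]
    _ = ‖T x i‖ := by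
        rw [PiLp.norm_eq_of_L1]
        exact hτbij.sum_comp fun l => ‖T x i l‖
    _ ≤ ‖T x‖ := norm_le_pi_norm _ i

-- With real scalars there are finitely many extreme functionals, so the injective map `f ↦ c⁻¹ • (f
-- ∘ₗ T)` is onto them. A functional norming `x` therefore comes from one evaluated at `T x`.
omit [DecidableEq ι] [DecidableEq κ] in
theorem mul_norm_le_norm_map_of_I_eq_zero [Nonempty ι]
    (hI : (RCLike.I : 𝕜) = 0) (hT : Function.Surjective T) {c : ℝ} (hc : 0 < c)
    (h : ∀ i u, (∀ j, ‖u j‖ = 1) → ∃ i' u', (∀ j, ‖u' j‖ = 1) ∧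
      rowFunctional i u ∘ₗ T = (c : 𝕜) • rowFunctional i' u') (x : RowSpace 𝕜 ι κ) :
    c * ‖x‖ ≤ ‖T x‖ := by
  have hcK : (c : 𝕜) ≠ 0 := by exact_mod_cast hc.ne'
  set S : Set (RowSpace 𝕜 ι κ →ₗ[𝕜] 𝕜) :=
    {f | ∃ i u, (∀ j, ‖u j‖ = 1) ∧ f = rowFunctional i u} with hS
  have hfin : S.Finite := by
    have hU : {u : κ → 𝕜 | ∀ j, ‖u j‖ = 1}.Finite := by
      have := Set.Finite.pi' (t := fun _ : κ => {u : 𝕜 | ‖u‖ = 1}) fun _ => finite_norm_eq_one hI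
      exact this
    refine ((Set.finite_univ (α := ι)).image2 rowFunctional hU).subset ?_
    rintro _ ⟨i, u, hu, rfl⟩
    exact ⟨i, trivial, u, hu, rfl⟩
  have hmaps : Set.MapsTo (fun f => (c : 𝕜)⁻¹ • (f ∘ₗ T)) S S := by
    rintro _ ⟨i, u, hu, rfl⟩
    obtain ⟨i', u', hu', he⟩ := h i u hu
    exact ⟨i', u', hu', by simp only [he]; rw [smul_smul, inv_mul_cancel₀ hcK, one_smul]⟩
  have hinj : Set.InjOn (fun f : RowSpace 𝕜 ι κ →ₗ[𝕜] 𝕜 => (c : 𝕜)⁻¹ • (f ∘ₗ T)) S := by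
    intro f _ g _ hfg
    have h1 : f ∘ₗ T = g ∘ₗ T := smul_right_injective _ (inv_ne_zero hcK) hfg
    ext1 z
    obtain ⟨y, rfl⟩ := hT z
    exact LinearMap.congr_fun h1 y
  obtain ⟨i, u, hu, hx⟩ := exists_norm_rowFunctional_eq x
  have : Finite S := hfin
  obtain ⟨⟨_, i', u', hu', rfl⟩, hf⟩ := (Finite.injective_iff_surjective.mp
    ((Set.MapsTo.restrict_inj hmaps).mpr hinj)) ⟨rowFunctional i u, i, u, hu, rfl⟩
  have h1 := LinearMap.congr_fun (congrArg Subtype.val hf) x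
  simp only [Set.MapsTo.val_restrict_apply, LinearMap.smul_apply, LinearMap.comp_apply] at h1
  rw [← hx, ← h1, norm_smul, norm_inv, RCLike.norm_ofReal, abs_of_pos hc, ← mul_assoc,
    mul_inv_cancel₀ hc.ne', one_mul]
  exact norm_rowFunctional_le i' hu' (T x)

theorem PreservesParallelPairs.isScalarMultipleOfIsometry [Nontrivial ι] [Nontrivial κ]
    (hT : PreservesParallelPairs T) (hrank : 1 < T.rank) : IsScalarMultipleOfIsometry T := by
  obtain ⟨Φ, hΦ⟩ := exists_isTestFamily T
  have hrow : ∀ i (v : PiLp 1 (fun _ : κ => 𝕜)), T (Pi.single i v) = 0 → v = 0 := by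
    intro i v hv
    by_contra hv0
    exact hrank.not_ge (rank_le_one_of_map_single_eq_zero hT hΦ hv0 hv)
  have hinj := injective_of_isTestFamily hT hΦ hrow
  have hsurj : Function.Surjective T := LinearMap.injective_iff_surjective.mp hinj
  obtain ⟨c, hc, hΨ⟩ := exists_eq_smul_rowFunctional hT (isTestFamily_rowFunctional_comp hsurj) hrow
  have h : ∀ i u, (∀ j, ‖u j‖ = 1) → ∃ i' u', (∀ j, ‖u' j‖ = 1) ∧
      rowFunctional i u ∘ₗ T = (c : 𝕜) • rowFunctional i' u' :=
    fun i u hu => hΨ _ ⟨i, u, hu, rfl⟩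
  have hle : ∀ x, ‖T x‖ ≤ c * ‖x‖ := fun x => by
    obtain ⟨i, u, hu, hx⟩ := exists_norm_rowFunctional_eq (T x)
    obtain ⟨i', u', hu', he⟩ := h i u hu
    rw [← hx, ← LinearMap.comp_apply, he, LinearMap.smul_apply, norm_smul, RCLike.norm_ofReal,
      abs_of_pos hc]
    exact mul_le_mul_of_nonneg_left (norm_rowFunctional_le i' hu' x) hc.le
  have hge : ∀ x, c * ‖x‖ ≤ ‖T x‖ := fun x => by
    by_cases hI : (RCLike.I : 𝕜) = 0
    · exact mul_norm_le_norm_map_of_I_eq_zero hI hsurj hc h x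
    · exact mul_norm_le_norm_map_of_I_ne_zero hI hinj hc h x
  have hcK : (c : 𝕜) ≠ 0 := by exact_mod_cast hc.ne'
  refine ⟨c, ⟨(c : 𝕜)⁻¹ • T, fun x => ?_⟩, ?_⟩
  · rw [LinearMap.smul_apply, norm_smul, (hle x).antisymm (hge x), norm_inv, RCLike.norm_ofReal,
      abs_of_pos hc, inv_mul_cancel_left₀ hc.ne']
  · ext1 x
    simp [smul_smul, hcK]

end RowSpace

/-! ### TEA preservers do not have rank one -/

namespace RowSpace

section TEA

variable {𝕜 : Type*} [RCLike 𝕜] {ι κ : Type*} [Fintype ι] [Fintype κ] [DecidableEq ι]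
  [DecidableEq κ] {T : RowSpace 𝕜 ι κ →ₗ[𝕜] RowSpace 𝕜 ι κ}

theorem norm_cell (i : ι) (j : κ) (a : 𝕜) : ‖cell i j a‖ = ‖a‖ := by
  rw [cell, Pi.norm_single, PiLp.norm_single]

theorem norm_cell_add_cell_same_row (i : ι) {j j' : κ} (h : j ≠ j') (a b : 𝕜) :
    ‖cell i j a + cell i j' b‖ = ‖a‖ + ‖b‖ := by
  rw [cell, cell, ← Pi.single_add, Pi.norm_single, norm_row_add_single, PiLp.norm_single]
  simp [h.symm]

theorem norm_cell_add_cell_of_ne {i i' : ι} (h : i ≠ i') (j j' : κ) {a b : 𝕜} (hab : ‖b‖ ≤ ‖a‖) :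
    ‖cell i j a + cell i' j' b‖ = ‖a‖ := by
  refine le_antisymm ((pi_norm_le_iff_of_nonneg (norm_nonneg _)).mpr fun k => ?_) ?_
  · by_cases hk : k = i
    · subst hk
      rw [Pi.add_apply, cell_apply_same, cell_apply_of_ne h, add_zero, PiLp.norm_single]
    · rw [Pi.add_apply, cell_apply_of_ne hk, zero_add]
      exact (norm_le_pi_norm _ k).trans ((norm_cell i' j' b).trans_le hab)
  · refine le_trans (le_of_eq ?_) (norm_le_pi_norm _ i)
    rw [Pi.add_apply, cell_apply_same, cell_apply_of_ne h, add_zero, PiLp.norm_single]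

theorem PreservesTEAPairs.one_lt_rank [Nontrivial ι] [Nontrivial κ]
    (hT : PreservesTEAPairs T) (h0 : T ≠ 0) : 1 < T.rank := by
  by_contra hrank
  obtain ⟨⟨w, hwT⟩, hw⟩ := rank_le_one_iff.mp (not_lt.mp hrank)
  have hex : ∀ x, ∃ r : 𝕜, T x = r • w := fun x => by
    obtain ⟨r, hr⟩ := hw (T.rangeRestrict x)
    exact ⟨r, (congrArg Subtype.val hr).symm⟩
  choose ψ hψ using hex
  have hw0 : w ≠ 0 := by
    rintro rfl
    exact h0 (LinearMap.ext fun x => by simp [hψ x])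
  have hinj := smul_left_injective 𝕜 hw0
  have hadd : ∀ x y, ψ (x + y) = ψ x + ψ y := fun x y => hinj (by
    simp only [add_smul, ← hψ, map_add])
  have hneg : ∀ i j, ψ (cell i j (-1)) = -ψ (cell i j 1) := fun i j => hinj (by
    simp only [neg_smul, ← hψ]
    rw [cell_eq_smul, map_smul, neg_smul, one_smul])
  have hTEA : ∀ x y, ‖x + y‖ = ‖x‖ + ‖y‖ → ‖ψ x + ψ y‖ = ‖ψ x‖ + ‖ψ y‖ := fun x y hxy => by
    have h : ‖T x + T y‖ = ‖T x‖ + ‖T y‖ := hT x y hxy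
    rw [hψ, hψ, ← add_smul, norm_smul, norm_smul, norm_smul, ← add_mul] at h
    exact mul_right_cancel₀ (norm_ne_zero_iff.mpr hw0) h
  -- Cells in one row form a TEA pair with either sign, so two scalars would be aligned both with
  -- and against each other.
  have hsame : ∀ i j j', j ≠ j' → ‖ψ (cell i j 1)‖ * ‖ψ (cell i j' 1)‖ = 0 := fun i j j' hj => by
    have h1 := hTEA (cell i j 1) (cell i j' 1)
      (by rw [norm_cell_add_cell_same_row i hj, norm_cell, norm_cell])
    have h2 := hTEA (cell i j 1) (cell i j' (-1))
      (by rw [norm_cell_add_cell_same_row i hj, norm_cell, norm_cell])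
    rw [hneg, norm_neg] at h2
    have h1' := congrArg (· ^ 2) h1
    have h2' := congrArg (· ^ 2) h2
    simp only [norm_add_sq_rclike, norm_neg, mul_neg, map_neg] at h1' h2'
    nlinarith
  -- For cells `a`, `b` in different rows, `a + b` and `a - b` form a TEA pair, whence `2|ψ b| ≤ |ψ
  -- (a + b)| + |ψ (a - b)| = 2|ψ a|`.
  have hle : ∀ i i', i ≠ i' → ∀ j j', ‖ψ (cell i' j' 1)‖ ≤ ‖ψ (cell i j 1)‖ := by
    intro i i' hi j j'
    have hsum : (cell i j 1 + cell i' j' 1) + (cell i j 1 + cell i' j' (-1)) =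
        (2 : 𝕜) • cell i j (1 : 𝕜) := by
      rw [cell_eq_smul i' j' (-1)]; module
    have h1 := hTEA (cell i j 1 + cell i' j' 1) (cell i j 1 + cell i' j' (-1)) (by
      rw [hsum, norm_smul, norm_cell, norm_cell_add_cell_of_ne hi _ _ le_rfl,
        norm_cell_add_cell_of_ne hi _ _ (by simp)]
      simp; norm_num)
    simp only [hadd, hneg] at h1
    set α := ψ (cell i j 1)
    set β := ψ (cell i' j' 1)
    have h2 : ‖(2 : 𝕜) * β‖ ≤ ‖α + β‖ + ‖α + -β‖ := by
      rw [show (2 : 𝕜) * β = (α + β) - (α + -β) by ring]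
      exact norm_sub_le _ _
    rw [← h1, show α + β + (α + -β) = 2 * α by ring, norm_mul, norm_mul, RCLike.norm_two] at h2
    linarith
  refine h0 (LinearMap.ext fun x => ?_)
  rw [eq_sum_cell x, map_sum]
  refine Finset.sum_eq_zero fun i _ => ?_
  rw [map_sum]
  refine Finset.sum_eq_zero fun j _ => ?_
  obtain ⟨i', hi⟩ := exists_ne i
  obtain ⟨j', hj⟩ := exists_ne j
  have h1 := (hle i' i hi j j).trans (hle i i' hi.symm j' j)
  have h2 := hsame i j j' hj.symm
  have h3 : ‖ψ (cell i j 1)‖ = 0 := by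
    nlinarith [norm_nonneg (ψ (cell i j 1)), norm_nonneg (ψ (cell i j' 1))]
  rw [map_smul, hψ, norm_eq_zero.mp h3, zero_smul, smul_zero]

end TEA

end RowSpace

/-! ### Transport along isometries and the equivalences -/

section Transport

universe u

variable {𝕜 : Type u} [RCLike 𝕜] {X Y : Type u} [NormedAddCommGroup X] [NormedSpace 𝕜 X]
  [NormedAddCommGroup Y] [NormedSpace 𝕜 Y]

theorem PreservesTEAPairs.conj {T : X →ₗ[𝕜] X} (h : PreservesTEAPairs T) (e : X ≃ₗᵢ[𝕜] Y) :
    PreservesTEAPairs (e.toLinearEquiv.conj T) := by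
  intro x y hxy
  have := h (e.symm x) (e.symm y) (by
    unfold IsTEAPair at *
    rw [← map_add, e.symm.norm_map, e.symm.norm_map, e.symm.norm_map, hxy])
  unfold IsTEAPair at *
  rw [← map_add, ← e.norm_map, ← e.norm_map (T _), ← e.norm_map (T (e.symm y)), map_add, map_add]
    at this
  exact this

theorem PreservesParallelPairs.conj {T : X →ₗ[𝕜] X} (h : PreservesParallelPairs T)
    (e : X ≃ₗᵢ[𝕜] Y) : PreservesParallelPairs (e.toLinearEquiv.conj T) := by
  rintro x y ⟨c, hc, hxy⟩
  obtain ⟨d, hd, this⟩ := h (e.symm x) (e.symm y) ⟨c, hc, by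
    rw [← map_smul, ← map_add, e.symm.norm_map, e.symm.norm_map, e.symm.norm_map, hxy]⟩
  refine ⟨d, hd, ?_⟩
  rw [← e.norm_map, ← e.norm_map (T _), ← e.norm_map (T (e.symm y)), map_add, map_smul] at this
  exact this

theorem IsScalarMultipleOfIsometry.of_conj {T : X →ₗ[𝕜] X} (e : X ≃ₗᵢ[𝕜] Y)
    (h : IsScalarMultipleOfIsometry (e.toLinearEquiv.conj T)) : IsScalarMultipleOfIsometry T := by
  obtain ⟨c, U, hU⟩ := h
  refine ⟨c, (e.symm.toLinearIsometry.comp U).comp e.toLinearIsometry, LinearMap.ext fun x => ?_⟩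
  have h1 : e (T x) = c • U (e x) := by
    simpa [LinearEquiv.conj_apply] using LinearMap.congr_fun hU (e x)
  have h2 := congrArg e.symm h1
  rw [e.symm_apply_apply, map_smul] at h2
  exact h2

theorem rank_conj (T : X →ₗ[𝕜] X) (e : X ≃ₗ[𝕜] Y) : (e.conj T).rank = T.rank := by
  have h : ∀ {X Y : Type u} [AddCommGroup X] [Module 𝕜 X] [AddCommGroup Y] [Module 𝕜 Y]
      (T : X →ₗ[𝕜] X) (e : X ≃ₗ[𝕜] Y), (e.conj T).rank ≤ T.rank := fun T e =>
    (LinearMap.rank_comp_le_left _ _).trans (LinearMap.rank_comp_le_right _ _)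
  refine le_antisymm (h T e) ?_
  have h1 : e.symm.conj (e.conj T) = T := by
    ext x
    simp [LinearEquiv.conj_apply]
  have h2 := h (e.conj T) e.symm
  rwa [h1] at h2

theorem tfae_of_linearIsometryEquiv {ι κ : Type} [Fintype ι] [Fintype κ] [DecidableEq ι]
    [DecidableEq κ] [Nontrivial ι] [Nontrivial κ] (e : X ≃ₗᵢ[𝕜] RowSpace 𝕜 ι κ)
    (T : X →ₗ[𝕜] X) (hT : T ≠ 0) :
    List.TFAE [
      PreservesTEAPairs T,
      PreservesParallelPairs T ∧ 1 < T.rank,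
      PreservesParallelPairs T ∧ IsUnit T,
      IsScalarMultipleOfIsometry T] := by
  have : FiniteDimensional 𝕜 X := e.symm.toLinearEquiv.finiteDimensional
  have hTEA : ∀ S : X →ₗ[𝕜] X, S ≠ 0 → PreservesTEAPairs S → 1 < S.rank := fun S hS h => by
    rw [← rank_conj S e.toLinearEquiv]
    refine RowSpace.PreservesTEAPairs.one_lt_rank (h.conj e) fun h0 => hS ?_
    exact (LinearEquiv.map_eq_zero_iff _).mp h0
  tfae_have 1 → 2 := fun h => ⟨h.preservesParallelPairs, hTEA T hT h⟩
  tfae_have 2 → 4 := fun h => by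
    refine IsScalarMultipleOfIsometry.of_conj e ?_
    refine RowSpace.PreservesParallelPairs.isScalarMultipleOfIsometry (h.1.conj e) ?_
    rw [rank_conj]
    exact h.2
  tfae_have 4 → 1 := fun h => h.preservesTEAPairs
  tfae_have 4 → 3 := fun h => ⟨h.preservesTEAPairs.preservesParallelPairs, h.isUnit hT⟩
  tfae_have 3 → 2 := fun h => by
    refine ⟨h.1, ?_⟩
    obtain ⟨S, hS⟩ := h.2.exists_left_inv
    -- The identity preserves TEA pairs, so it has rank above one; the left inverse passes this to
    -- `T`.
    have h1 : 1 < LinearMap.rank (S * T) := by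
      rw [hS]
      exact hTEA 1 (fun h0 => hT (by rw [← mul_one T, h0, mul_zero])) fun x y hxy => hxy
    exact h1.trans_le (LinearMap.rank_comp_le_right T S)
  tfae_finish

end Transport

/-! ### Operators as arrays of columns or rows -/

section Operators

variable {𝕜 : Type*} [RCLike 𝕜]

/-- An operator on `ℓ₁`, viewed as the family of its columns. -/
noncomputable def OpSpace.columns (n m : ℕ) :
    OpSpace 𝕜 1 n m →ₗᵢ[𝕜] RowSpace 𝕜 (Fin n) (Fin m) where
  toFun A := fun i => A (PiLp.single 1 i 1)
  map_add' A B := rfl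
  map_smul' c A := rfl
  norm_map' A := by
    refine le_antisymm ((pi_norm_le_iff_of_nonneg (norm_nonneg _)).mpr fun i => ?_)
      (A.opNorm_le_bound (norm_nonneg _) fun x => ?_)
    · refine (A.le_opNorm _).trans ?_
      rw [PiLp.norm_single, norm_one, mul_one]
    · have hx : x = ∑ i, x i • PiLp.single 1 i (1 : 𝕜) := by
        ext j; simp [Pi.single_apply]
      conv_lhs => rw [hx, map_sum]
      rw [PiLp.norm_eq_of_L1 x, Finset.mul_sum]
      refine (norm_sum_le _ _).trans (Finset.sum_le_sum fun i _ => ?_)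
      rw [map_smul, norm_smul, mul_comm]
      exact mul_le_mul_of_nonneg_right
        (norm_le_pi_norm (fun i => A (PiLp.single 1 i 1) : RowSpace 𝕜 (Fin n) (Fin m)) i)
        (norm_nonneg _)

theorem OpSpace.columns_surjective (n m : ℕ) :
    Function.Surjective (OpSpace.columns (𝕜 := 𝕜) n m) := by
  intro x
  refine ⟨∑ i, (PiLp.proj 1 (fun _ : Fin n => 𝕜) i).smulRight (x i), ?_⟩
  ext i j
  simp [OpSpace.columns]

/-- An operator on `ℓ∞`, viewed as the family of its rows. -/
noncomputable def OpSpace.rows (n m : ℕ) :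
    OpSpace 𝕜 ∞ n m →ₗᵢ[𝕜] RowSpace 𝕜 (Fin m) (Fin n) where
  toFun A := fun i => WithLp.toLp 1 fun j => A (PiLp.single ∞ j 1) i
  map_add' A B := rfl
  map_smul' c A := rfl
  norm_map' A := by
    have hA : ∀ x i, A x i = ∑ j, x j * A (PiLp.single ∞ j 1) i := fun x i => by
      have hx : x = ∑ i, x i • PiLp.single ∞ i (1 : 𝕜) := by
        ext j; simp [Pi.single_apply]
      conv_lhs => rw [hx, map_sum]
      simp
    refine le_antisymm ((pi_norm_le_iff_of_nonneg (norm_nonneg _)).mpr fun i => ?_)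
      (A.opNorm_le_bound (norm_nonneg _) fun x => ?_)
    -- The unimodular vector `u`, of sup norm at most one, realizes the `ℓ₁` norm of row `i`.
    · choose u hu hux using fun j => RCLike.exists_norm_eq_mul_self (A (PiLp.single ∞ j 1) i)
      have hn : ‖(WithLp.toLp ∞ u : PiLp ∞ fun _ : Fin n => 𝕜)‖ ≤ 1 := by
        rw [PiLp.norm_toLp]
        exact (pi_norm_le_iff_of_nonneg zero_le_one).mpr fun j => (hu j).le
      have h1 : ‖A (WithLp.toLp ∞ u) i‖ ≤ ‖A‖ := by
        refine le_trans (PiLp.norm_apply_le _ i) ((A.le_opNorm _).trans ?_)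
        exact mul_le_of_le_one_right (norm_nonneg _) hn
      refine le_trans (le_of_eq ?_) h1
      rw [hA, Finset.sum_congr rfl fun j _ => (hux j).symm, ← RCLike.ofReal_sum,
        RCLike.norm_ofReal, abs_of_nonneg (Finset.sum_nonneg fun j _ => norm_nonneg _),
        PiLp.norm_eq_of_L1]
      rfl
    · rw [← PiLp.norm_ofLp]
      refine (pi_norm_le_iff_of_nonneg (by positivity)).mpr fun i => ?_
      rw [hA]
      refine (norm_sum_le _ _).trans ?_
      refine le_trans ?_ (mul_le_mul_of_nonneg_right (norm_le_pi_norm (fun i => WithLp.toLp 1 fun j =>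
        A (PiLp.single ∞ j 1) i : RowSpace 𝕜 (Fin m) (Fin n)) i) (norm_nonneg _))
      rw [PiLp.norm_eq_of_L1, Finset.sum_mul]
      refine Finset.sum_le_sum fun j _ => ?_
      rw [norm_mul, mul_comm]
      exact mul_le_mul_of_nonneg_left (PiLp.norm_apply_le x j) (norm_nonneg _)

theorem OpSpace.rows_apply (n m : ℕ) (A : OpSpace 𝕜 ∞ n m) (i : Fin m) (j : Fin n) :
    OpSpace.rows (𝕜 := 𝕜) n m A i j = A (PiLp.single ∞ j 1) i := rfl

theorem OpSpace.rows_surjective (n m : ℕ) :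
    Function.Surjective (OpSpace.rows (𝕜 := 𝕜) n m) := by
  intro x
  refine ⟨∑ i, ∑ j, (x i j) • (PiLp.proj ∞ (fun _ : Fin n => 𝕜) j).smulRight
    (PiLp.single ∞ i (1 : 𝕜) : PiLp ∞ fun _ : Fin m => 𝕜), ?_⟩
  ext i j
  rw [OpSpace.rows_apply]
  simp [Pi.single_apply]

theorem OpSpace.tfae_one (m n : ℕ) [Nontrivial (Fin m)] [Nontrivial (Fin n)]
    (T : OpSpace 𝕜 1 n m →ₗ[𝕜] OpSpace 𝕜 1 n m) (hT : T ≠ 0) :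
    List.TFAE [
      PreservesTEAPairs T,
      PreservesParallelPairs T ∧ 1 < T.rank,
      PreservesParallelPairs T ∧ IsUnit T,
      IsScalarMultipleOfIsometry T] := by
  have e : OpSpace 𝕜 1 n m ≃ₗᵢ[𝕜] RowSpace 𝕜 (Fin n) (Fin m) :=
    LinearIsometryEquiv.ofSurjective (OpSpace.columns n m) (OpSpace.columns_surjective n m)
  exact tfae_of_linearIsometryEquiv e T hT

theorem OpSpace.tfae_top (m n : ℕ) [Nontrivial (Fin m)] [Nontrivial (Fin n)]
    (T : OpSpace 𝕜 ∞ n m →ₗ[𝕜] OpSpace 𝕜 ∞ n m) (hT : T ≠ 0) :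
    List.TFAE [
      PreservesTEAPairs T,
      PreservesParallelPairs T ∧ 1 < T.rank,
      PreservesParallelPairs T ∧ IsUnit T,
      IsScalarMultipleOfIsometry T] := by
  have e : OpSpace 𝕜 ∞ n m ≃ₗᵢ[𝕜] RowSpace 𝕜 (Fin m) (Fin n) :=
    LinearIsometryEquiv.ofSurjective (OpSpace.rows n m) (OpSpace.rows_surjective n m)
  exact tfae_of_linearIsometryEquiv e T hT

end Operators

theorem theorem1 {𝕜 : Type*} [RCLike 𝕜] (p : ℝ≥0∞) [Fact (1 ≤ p)] (hp : p = 1 ∨ p = ∞)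
    (m n : ℕ) (hm : 2 ≤ m) (hn : 2 ≤ n)
    (T : OpSpace 𝕜 p n m →ₗ[𝕜] OpSpace 𝕜 p n m) (hT : T ≠ 0) :
    List.TFAE [
      PreservesTEAPairs T,
      PreservesParallelPairs T ∧ 1 < T.rank,
      PreservesParallelPairs T ∧ IsUnit T,
      IsScalarMultipleOfIsometry T] := by
  have : Nontrivial (Fin m) := Fin.nontrivial_iff_two_le.mpr hm
  have : Nontrivial (Fin n) := Fin.nontrivial_iff_two_le.mpr hn
  rcases hp with rfl | rfl
  · exact OpSpace.tfae_one m n T hT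
  · exact OpSpace.tfae_top m n T hT
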